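/- Let $\mathcal G=(\mathcal V,\mathcal E)$ be a finite directed graph on $N$ nodes (loops allowed, no multiple edges), with adjacency matrix $\mathbf A=(a_{i,j})$, where $a_{i,j}=1$ if there is an edge from node $j$ to node $i$ and $a_{i,j}=0$ otherwise. Let $d_i^{\mathrm{in}}=\sum_j a_{i,j}$ and $d_j^{\mathrm{out}}=\sum_i a_{i,j}$ be the in- and out-degrees, and $\mathbf D_{\mathrm{in}}$, $\mathbf D_{\mathrm{out}}$ the corresponding diagonal matrices. Assume that every node has positive in-degree; for nodes of out-degree zero, if there are any, use the convention $0^{-1/2}=0$. The symmetrically normalized adjacency (SNA) is $\mathbf L=\mathbf D_{\mathrm{in}}^{-1/2}\mathbf A\,\mathbf D_{\mathrm{out}}^{-1/2}$. The graph is called weakly balanced if there is a vector $\mathbf k\in\mathbb R^N$, $\mathbf k\neq 0$, such that $$\sum_{j=1}^N a_{i,j}\left(\frac{k_j}{\sqrt{d_j^{\mathrm{out}}}}-\frac{k_i}{\sqrt{d_i^{\mathrm{in}}}}\right)=0\qquad\text{for all } i\in\{1,\dots,N\}.$$ The period of a graph is the greatest common divisor of the lengths of its directed closed walks of positive length (equivalently,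 of its directed cycles). Then $1$ is a (complex) eigenvalue of $\mathbf L$ if and only if $\mathcal G$ is weakly balanced. If moreover $\mathcal G$ is strongly connected, then $-1$ is an eigenvalue of $\mathbf L$ if and only if $\mathcal G$ is weakly balanced and its period is even. -/

import Mathlib

namespace Digraph

variable {V : Type*}

open Classical in
/-- The adjacency matrix: `a i j = 1` if there is an edge directed from node `j` to node `i`,
and `0` otherwise. -/
noncomputable def adjMatrix (G : Digraph V) : Matrix V V ℝ :=
  Matrix.of fun i j => if G.Adj j i then 1 else 0

/-- The in-degrees, the entries of the vector `A 1`. -/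
noncomputable def inDegree [Fintype V] (G : Digraph V) : V → ℝ :=
  Matrix.mulVec G.adjMatrix 1

/-- The out-degrees, the entries of the vector `Aᵀ 1`. -/
noncomputable def outDegree [Fintype V] (G : Digraph V) : V → ℝ :=
  Matrix.mulVec G.adjMatrix.transpose 1

/-- The symmetrically normalized adjacency `D_in^(-1/2) A D_out^(-1/2)`
(with `0^(-1/2) = 0`). -/
noncomputable def sna [Fintype V] [DecidableEq V] (G : Digraph V) : Matrix V V ℝ :=
  Matrix.diagonal (fun i => (Real.sqrt (G.inDegree i))⁻¹) * G.adjMatrix *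
    Matrix.diagonal (fun j => (Real.sqrt (G.outDegree j))⁻¹)

/-- The complex number `μ` is an eigenvalue of the symmetrically normalized adjacency,
seen as a complex matrix. -/
def IsSnaEigenvalue [Fintype V] [DecidableEq V] (G : Digraph V) (μ : ℂ) : Prop :=
  Module.End.HasEigenvalue (Matrix.toLin' (G.sna.map (fun x : ℝ => (x : ℂ)))) μ

/-- Weak balance: some nonzero real vector `k` satisfies
`∑ j, a i j * (k j / √(d_out j) - k i / √(d_in i)) = 0` for every node `i`. -/
def WeaklyBalanced [Fintype V] (G : Digraph V) : Prop :=
  ∃ k : V → ℝ, k ≠ 0 ∧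
    ∀ i, ∑ j, G.adjMatrix i j *
      (k j / Real.sqrt (G.outDegree j) - k i / Real.sqrt (G.inDegree i)) = 0

/-- There is a directed walk with `n` edges from `u` to `v`. -/
def HasWalk (G : Digraph V) (n : ℕ) (u v : V) : Prop :=
  ∃ w : ℕ → V, w 0 = u ∧ w n = v ∧ ∀ i < n, G.Adj (w i) (w (i + 1))

/-- Every node can be reached from every node by a (possibly empty) directed walk. -/
def StronglyConnected (G : Digraph V) : Prop :=
  ∀ u v : V, ∃ n : ℕ, G.HasWalk n u v

/-- The period: the greatest common divisor of the lengths of all directed closed walks of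
positive length (equivalently, of all directed cycles). It is `0` if there are none. -/
noncomputable def period (G : Digraph V) : ℕ :=
  sSup {d : ℕ | ∀ n : ℕ, 0 < n → (∃ v : V, G.HasWalk n v v) → d ∣ n}

end Digraph

namespace Digraph

variable {V : Type*}

/-! For `c = ±1` and `L k = c k`, put `x j = k j / √d_out j` and `y i = c * k i / √d_in i`.
Expanding squares gives `∑ a i j * (x j - y i) ^ 2 = ∑ d_out j * x j ^ 2 - ∑ k i ^ 2 ≤ 0`, so `x j =
y i` on every edge (`sna_mulVec_eq_smul_iff_forall_adj`). For `c = 1` the eigenvector equation is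
weak balance itself. For `c = -1`, absolute values turn `k` into a balanced vector, while its signs
alternate along edges and force even closed walks; conversely, an alternating sign times a balanced
vector is an eigenvector for `-1`. -/

theorem adjMatrix_of_adj (G : Digraph V) {i j : V} (h : G.Adj j i) : G.adjMatrix i j = 1 := by
  simp [adjMatrix, h]

theorem adjMatrix_of_not_adj (G : Digraph V) {i j : V} (h : ¬ G.Adj j i) :
    G.adjMatrix i j = 0 := by
  simp [adjMatrix, h]

theorem adjMatrix_nonneg (G : Digraph V) (i j : V) : 0 ≤ G.adjMatrix i j := by
  by_cases h : G.Adj j i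
  · simp [G.adjMatrix_of_adj h]
  · simp [G.adjMatrix_of_not_adj h]

/-! ### Real eigenvectors and edgewise balance -/

section Degree

variable [Fintype V]

theorem inDegree_eq_sum (G : Digraph V) (i : V) : G.inDegree i = ∑ j, G.adjMatrix i j := by
  simp [inDegree, Matrix.mulVec, dotProduct]

theorem outDegree_eq_sum (G : Digraph V) (j : V) : G.outDegree j = ∑ i, G.adjMatrix i j := by
  simp [outDegree, Matrix.mulVec, dotProduct]

theorem outDegree_pos_of_adj (G : Digraph V) {i j : V} (h : G.Adj j i) : 0 < G.outDegree j := by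
  rw [outDegree_eq_sum]
  exact Finset.sum_pos' (fun i _ => G.adjMatrix_nonneg i j)
    ⟨i, Finset.mem_univ _, by simp [G.adjMatrix_of_adj h]⟩

variable [DecidableEq V]

theorem sna_mulVec_apply (G : Digraph V) (k : V → ℝ) (i : V) :
    (G.sna.mulVec k) i = (Real.sqrt (G.inDegree i))⁻¹ *
      ∑ j, G.adjMatrix i j * (k j / Real.sqrt (G.outDegree j)) := by
  simp only [sna, Matrix.mulVec, dotProduct, Matrix.mul_diagonal, Matrix.diagonal_mul,
    Finset.mul_sum]
  refine Finset.sum_congr rfl fun j _ => ?_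
  ring

/-- Since the matrix and `c` are real, the real and imaginary parts of a complex eigenvector both
solve the equation, and one of them is nonzero. -/
theorem isSnaEigenvalue_ofReal_iff (G : Digraph V) (c : ℝ) :
    G.IsSnaEigenvalue (c : ℂ) ↔ ∃ k : V → ℝ, k ≠ 0 ∧ G.sna.mulVec k = c • k := by
  constructor
  · intro h
    obtain ⟨v, hv⟩ := Module.End.HasEigenvalue.exists_hasEigenvector h
    have hv1 : ∀ i, ∑ j, (G.sna i j : ℂ) * v j = c * v i := by
      intro i
      simpa [Matrix.mulVec, dotProduct] using congrFun hv.apply_eq_smul i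
    by_cases hre : (fun i => (v i).re) = 0
    · refine ⟨fun i => (v i).im, fun him => hv.2 ?_, ?_⟩
      · ext i
        exact Complex.ext (congrFun hre i) (congrFun him i)
      · ext i
        simpa [Matrix.mulVec, dotProduct] using congrArg Complex.im (hv1 i)
    · refine ⟨fun i => (v i).re, hre, ?_⟩
      ext i
      simpa [Matrix.mulVec, dotProduct] using congrArg Complex.re (hv1 i)
  · rintro ⟨k, hk, h⟩
    refine Module.End.hasEigenvalue_of_hasEigenvector (x := fun i => (k i : ℂ)) ?_
    refine ⟨Module.End.mem_eigenspace_iff.mpr ?_, fun h0 => hk ?_⟩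
    · ext i
      have := congrArg (fun x : ℝ => (x : ℂ)) (congrFun h i)
      simpa [Matrix.mulVec, dotProduct] using this
    · ext i
      simpa using congrFun h0 i

theorem sna_mulVec_eq_smul_iff (G : Digraph V) (hin : ∀ i : V, 0 < G.inDegree i)
    (k : V → ℝ) (c : ℝ) :
    G.sna.mulVec k = c • k ↔
      ∀ i, ∑ j, G.adjMatrix i j *
        (k j / Real.sqrt (G.outDegree j) - c * (k i / Real.sqrt (G.inDegree i))) = 0 := by
  rw [funext_iff]
  refine forall_congr' fun i => ?_
  have hs : 0 < Real.sqrt (G.inDegree i) := Real.sqrt_pos.mpr (hin i)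
  have hd : G.inDegree i * (c * (k i / Real.sqrt (G.inDegree i))) =
      Real.sqrt (G.inDegree i) * (c * k i) := by
    conv_lhs => rw [← Real.mul_self_sqrt (hin i).le]
    rw [Real.sqrt_mul_self hs.le]
    field_simp
  simp only [mul_sub, Finset.sum_sub_distrib]
  rw [← Finset.sum_mul, ← inDegree_eq_sum, hd, sub_eq_zero, sna_mulVec_apply,
    inv_mul_eq_iff_eq_mul₀ hs.ne', Pi.smul_apply, smul_eq_mul]

/-- Eigenvectors of the normalized adjacency for `±1` are balanced along every single edge. -/
theorem sna_mulVec_eq_smul_iff_forall_adj (G : Digraph V) (hin : ∀ i : V, 0 < G.inDegree i)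
    (k : V → ℝ) {c : ℝ} (hc : c ^ 2 = 1) :
    G.sna.mulVec k = c • k ↔ ∀ i j, G.Adj j i →
      k j / Real.sqrt (G.outDegree j) = c * (k i / Real.sqrt (G.inDegree i)) := by
  rw [sna_mulVec_eq_smul_iff G hin]
  constructor
  · intro h
    set x : V → ℝ := fun j => k j / Real.sqrt (G.outDegree j) with hx
    set y : V → ℝ := fun i => c * (k i / Real.sqrt (G.inDegree i)) with hy
    -- The cross term of the square is a multiple of the sum that vanishes by `h i`.
    have hsum : ∀ i, ∑ j, G.adjMatrix i j * (x j - y i) ^ 2 =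
        ∑ j, G.adjMatrix i j * x j ^ 2 - k i ^ 2 := by
      intro i
      have hyi : G.inDegree i * y i ^ 2 = k i ^ 2 := by
        simp only [hy, mul_pow, hc, div_pow, Real.sq_sqrt (hin i).le]
        field_simp [(hin i).ne']
      have hexp : ∀ j, G.adjMatrix i j * (x j - y i) ^ 2 =
          G.adjMatrix i j * x j ^ 2 - G.adjMatrix i j * y i ^ 2
            - 2 * y i * (G.adjMatrix i j * (x j - y i)) := fun j => by ring
      rw [Finset.sum_congr rfl fun j _ => hexp j, Finset.sum_sub_distrib, Finset.sum_sub_distrib,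
        ← Finset.mul_sum, h i, ← Finset.sum_mul, ← inDegree_eq_sum, hyi]
      ring
    have hcol : ∀ j, ∑ i, G.adjMatrix i j * x j ^ 2 ≤ k j ^ 2 := by
      intro j
      rw [← Finset.sum_mul, ← outDegree_eq_sum]
      have h0 : 0 ≤ G.outDegree j := by
        rw [outDegree_eq_sum]
        exact Finset.sum_nonneg fun i _ => G.adjMatrix_nonneg i j
      simp only [hx, div_pow, Real.sq_sqrt h0]
      -- The inequality can be strict only at out-degree zero, where the convention makes `x j = 0`.
      rcases h0.eq_or_lt with h0 | h0
      · rw [← h0]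
        simpa using sq_nonneg (k j)
      · rw [mul_div_cancel₀ _ h0.ne']
    have hnonneg : ∀ i j, 0 ≤ G.adjMatrix i j * (x j - y i) ^ 2 := fun i j =>
      mul_nonneg (G.adjMatrix_nonneg i j) (sq_nonneg _)
    have htotal : ∑ i, ∑ j, G.adjMatrix i j * (x j - y i) ^ 2 = 0 := by
      refine le_antisymm ?_ (Finset.sum_nonneg fun i _ => Finset.sum_nonneg fun j _ => hnonneg i j)
      rw [Finset.sum_congr rfl fun i _ => hsum i, Finset.sum_sub_distrib, Finset.sum_comm]
      exact sub_nonpos.mpr (Finset.sum_le_sum fun j _ => hcol j)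
    intro i j hij
    have h1 := (Finset.sum_eq_zero_iff_of_nonneg fun i _ =>
      Finset.sum_nonneg fun j _ => hnonneg i j).mp htotal i (Finset.mem_univ i)
    have h2 := (Finset.sum_eq_zero_iff_of_nonneg fun j _ => hnonneg i j).mp h1 j
      (Finset.mem_univ j)
    rw [G.adjMatrix_of_adj hij, one_mul] at h2
    exact sub_eq_zero.mp (pow_eq_zero_iff two_ne_zero |>.mp h2)
  · intro h i
    refine Finset.sum_eq_zero fun j _ => ?_
    by_cases hij : G.Adj j i
    · rw [h i j hij, sub_self, mul_zero]
    · rw [G.adjMatrix_of_not_adj hij, zero_mul]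

theorem weaklyBalanced_iff_exists_mulVec_eq (G : Digraph V) (hin : ∀ i : V, 0 < G.inDegree i) :
    G.WeaklyBalanced ↔ ∃ k : V → ℝ, k ≠ 0 ∧ G.sna.mulVec k = (1 : ℝ) • k := by
  simp only [sna_mulVec_eq_smul_iff G hin, one_mul]
  rfl

end Degree

/-! ### Walks, parity and the period -/

section Walk

variable {G : Digraph V} {u v w : V} {m n : ℕ}

theorem HasWalk.append (h₁ : G.HasWalk m u v) (h₂ : G.HasWalk n v w) :
    G.HasWalk (m + n) u w := by
  obtain ⟨p, hp0, hpm, hp⟩ := h₁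
  obtain ⟨q, hq0, hqn, hq⟩ := h₂
  refine ⟨fun i => if i < m then p i else q (i - m), ?_, ?_, ?_⟩
  · by_cases hm : 0 < m
    · simpa [hm] using hp0
    · obtain rfl : m = 0 := by omega
      simp [hq0, ← hpm, hp0]
  · simpa using hqn
  · intro i hi
    by_cases h1 : i + 1 < m
    · simpa [h1, show i < m by omega] using hp i (by omega)
    · by_cases h2 : i < m
      · obtain rfl : m = i + 1 := by omega
        simpa [hq0, hpm] using hp i h2
      · have h3 := hq (i - m) (by omega)
        rw [show i - m + 1 = i + 1 - m by omega] at h3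
        simpa [h1, h2] using h3

theorem hasWalk_one_of_adj (h : G.Adj u v) : G.HasWalk 1 u v := by
  refine ⟨fun i => if i = 0 then u else v, by simp, by simp, fun i hi => ?_⟩
  obtain rfl : i = 0 := by omega
  simpa using h

/-- A quantity negated along every edge is multiplied by `(-1) ^ n` along walks of length `n`. -/
theorem HasWalk.eq_neg_one_pow_mul {f : V → ℝ} (hf : ∀ i j, G.Adj i j → f j = -f i)
    (h : G.HasWalk n u v) : f v = (-1) ^ n * f u := by
  obtain ⟨p, rfl, rfl, hp⟩ := h
  have : ∀ i ≤ n, f (p i) = (-1) ^ i * f (p 0) := by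
    intro i
    induction i with
    | zero => simp
    | succ i ih =>
      intro hi
      rw [hf _ _ (hp i (by omega)), ih (by omega)]
      ring
  exact this n le_rfl

/-- A closed walk bounds the common divisors, so the supremum is attained. If `2` is a common
divisor, so is its lcm with the period, and maximality makes the two equal. -/
theorem even_period_iff (hex : ∃ n : ℕ, 0 < n ∧ ∃ v : V, G.HasWalk n v v) :
    Even G.period ↔ ∀ n : ℕ, 0 < n → (∃ v : V, G.HasWalk n v v) → Even n := by
  obtain ⟨N, hN, hw⟩ := hex
  set S : Set ℕ := {d : ℕ | ∀ n : ℕ, 0 < n → (∃ v : V, G.HasWalk n v v) → d ∣ n} with hS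
  have hbdd : BddAbove S := ⟨N, fun d hd => Nat.le_of_dvd hN (hd N hN hw)⟩
  have hmem : G.period ∈ S := Nat.sSup_mem ⟨1, fun n _ _ => one_dvd n⟩ hbdd
  constructor
  · intro he n hn hv
    exact even_iff_two_dvd.mpr (he.two_dvd.trans (hmem n hn hv))
  · intro h
    have hlcm : Nat.lcm 2 G.period ∈ S := fun n hn hv =>
      Nat.lcm_dvd (h n hn hv).two_dvd (hmem n hn hv)
    have hle : Nat.lcm 2 G.period ≤ G.period := le_csSup hbdd hlcm
    have hpos : 0 < G.period := Nat.pos_of_dvd_of_pos (hmem N hN hw) hN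
    have heq : Nat.lcm 2 G.period = G.period :=
      le_antisymm hle (Nat.le_of_dvd (Nat.lcm_pos two_pos hpos) (Nat.dvd_lcm_right _ _))
    rw [even_iff_two_dvd, ← heq]
    exact Nat.dvd_lcm_left _ _

/-- In a strongly connected graph without odd closed walks there is a sign changing along every
edge. -/
theorem StronglyConnected.exists_alternating_sign [Nonempty V] (hG : G.StronglyConnected)
    (h : ∀ n : ℕ, 0 < n → (∃ v : V, G.HasWalk n v v) → Even n) :
    ∃ s : V → ℝ, (∀ i, s i ≠ 0) ∧ ∀ i j, G.Adj i j → s j = -s i := by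
  obtain ⟨u⟩ := ‹Nonempty V›
  choose ℓ hℓ using hG u
  refine ⟨fun i => (-1) ^ ℓ i, fun i => pow_ne_zero _ (by norm_num), fun i j hij => ?_⟩
  obtain ⟨m, hm⟩ := hG j u
  have h1 := h (ℓ i + 1 + m) (by omega) ⟨u, ((hℓ i).append (hasWalk_one_of_adj hij)).append hm⟩
  have h2 : Even (ℓ j + m) := by
    -- The chosen walks may both be empty, and `h` covers only positive lengths.
    rcases Nat.eq_zero_or_pos (ℓ j + m) with h0 | h0
    · simp [h0]
    · exact h _ h0 ⟨u, (hℓ j).append hm⟩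
  have h3 : Even (ℓ j) ↔ Even (ℓ i + 1) := by
    rw [Nat.even_add] at h1 h2
    rw [h1, h2]
  change (-1 : ℝ) ^ ℓ j = -(-1) ^ ℓ i
  rw [show -(-1 : ℝ) ^ ℓ i = (-1) ^ (ℓ i + 1) by ring]
  rcases Nat.even_or_odd (ℓ j) with hj | hj
  · rw [hj.neg_one_pow, (h3.mp hj).neg_one_pow]
  · have : Odd (ℓ i + 1) := by
      rw [← Nat.not_even_iff_odd] at hj ⊢
      rwa [← h3]
    rw [hj.neg_one_pow, this.neg_one_pow]

theorem exists_adj_of_inDegree_pos [Fintype V] {i : V} (h : 0 < G.inDegree i) :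
    ∃ j, G.Adj j i := by
  by_contra! hno
  rw [inDegree_eq_sum, Finset.sum_eq_zero fun j _ => G.adjMatrix_of_not_adj (hno j)] at h
  exact lt_irrefl _ h

theorem StronglyConnected.exists_closed_walk [Fintype V] (hG : G.StronglyConnected) {i : V}
    (h : 0 < G.inDegree i) : ∃ n : ℕ, 0 < n ∧ ∃ v : V, G.HasWalk n v v := by
  obtain ⟨j, hj⟩ := exists_adj_of_inDegree_pos h
  obtain ⟨n, hn⟩ := hG i j
  exact ⟨1 + n, by omega, j, (hasWalk_one_of_adj hj).append hn⟩

/-- A property passing backwards along edges holds everywhere once it holds somewhere. -/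
theorem StronglyConnected.forall_of_backward (hG : G.StronglyConnected) {P : V → Prop}
    (hP : ∀ i j, G.Adj i j → P j → P i) (hv : P v) (u : V) : P u := by
  obtain ⟨n, p, rfl, rfl, hp⟩ := hG u v
  exact Nat.decreasingInduction' (P := fun m => P (p m))
    (fun m hm _ h => hP _ _ (hp m hm) h) (Nat.zero_le n) hv

end Walk

/-! ### The eigenvalue `-1` -/

section Spectrum

variable [Fintype V] [DecidableEq V] {G : Digraph V}

theorem StronglyConnected.exists_mulVec_eq_neg_iff (hG : G.StronglyConnected)
    (hin : ∀ i : V, 0 < G.inDegree i) :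
    (∃ k : V → ℝ, k ≠ 0 ∧ G.sna.mulVec k = (-1 : ℝ) • k) ↔
      G.WeaklyBalanced ∧ Even G.period := by
  rw [weaklyBalanced_iff_exists_mulVec_eq G hin]
  simp only [sna_mulVec_eq_smul_iff_forall_adj G hin _ (show (1 : ℝ) ^ 2 = 1 by norm_num),
    sna_mulVec_eq_smul_iff_forall_adj G hin _ (show (-1 : ℝ) ^ 2 = 1 by norm_num), one_mul,
    neg_one_mul]
  have hs : ∀ i, 0 < Real.sqrt (G.inDegree i) := fun i => Real.sqrt_pos.mpr (hin i)
  have ht : ∀ {i j}, G.Adj i j → 0 < Real.sqrt (G.outDegree i) := fun h =>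
    Real.sqrt_pos.mpr (G.outDegree_pos_of_adj h)
  constructor
  · rintro ⟨k, hk, h⟩
    obtain ⟨v, hv⟩ := Function.ne_iff.mp hk
    -- Edgewise balance carries a zero of `k` forward along edges, hence nonvanishing backward.
    have hne : ∀ i, k i ≠ 0 := by
      refine hG.forall_of_backward (P := fun i => k i ≠ 0) (fun i j hij hj hi => hj ?_) hv
      have := h j i hij
      rw [hi, zero_div, eq_comm, neg_eq_zero, div_eq_zero_iff] at this
      exact this.resolve_right (hs j).ne'
    refine ⟨⟨fun i => |k i|, fun h0 => hne v (abs_eq_zero.mp (congrFun h0 v)), ?_⟩, ?_⟩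
    · intro i j hij
      have := congrArg abs (h i j hij)
      rwa [abs_neg, abs_div, abs_div, abs_of_pos (hs i), abs_of_pos (ht hij)] at this
    · rw [even_period_iff (hG.exists_closed_walk (hin v))]
      rintro n - ⟨w, hw⟩
      have hsign : ∀ i j, G.Adj i j →
          ((SignType.sign (k j) : SignType) : ℝ) = -((SignType.sign (k i) : SignType) : ℝ) := by
        intro i j hij
        have h1 : k i = -(k j * (Real.sqrt (G.outDegree i) / Real.sqrt (G.inDegree j))) := by
          have := h j i hij
          rw [div_eq_iff (ht hij).ne'] at this
          rw [this]
          ring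
        rw [h1, Left.sign_neg, sign_mul, sign_pos (div_pos (ht hij) (hs j)), mul_one]
        simp
      have h2 := hw.eq_neg_one_pow_mul hsign
      have h3 : ((SignType.sign (k w) : SignType) : ℝ) ≠ 0 := by
        rcases lt_or_gt_of_ne (hne w) with h4 | h4 <;> simp [h4]
      rw [eq_comm, mul_eq_right₀ h3] at h2
      exact (neg_one_pow_eq_one_iff_even (by norm_num)).mp h2
  · rintro ⟨⟨k, hk, h⟩, heven⟩
    obtain ⟨v, hv⟩ := Function.ne_iff.mp hk
    have : Nonempty V := ⟨v⟩
    obtain ⟨s, hs0, hsalt⟩ := hG.exists_alternating_sign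
      ((even_period_iff (hG.exists_closed_walk (hin v))).mp heven)
    refine ⟨fun i => s i * k i, fun h0 => ?_, fun i j hij => ?_⟩
    · exact (mul_ne_zero (hs0 v) hv) (congrFun h0 v)
    · rw [mul_div_assoc, mul_div_assoc, h i j hij, hsalt j i hij]
      ring

end Spectrum

end Digraph

theorem mainTheorem4 {V : Type*} [Fintype V] [DecidableEq V] (G : Digraph V)
    (hin : ∀ i : V, 0 < G.inDegree i) :
    (G.IsSnaEigenvalue 1 ↔ G.WeaklyBalanced) ∧
      (G.StronglyConnected →
        (G.IsSnaEigenvalue (-1) ↔ G.WeaklyBalanced ∧ Even G.period)) := by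
  refine ⟨?_, fun hG => ?_⟩
  · rw [G.weaklyBalanced_iff_exists_mulVec_eq hin, ← G.isSnaEigenvalue_ofReal_iff,
      Complex.ofReal_one]
  · rw [← hG.exists_mulVec_eq_neg_iff hin, ← G.isSnaEigenvalue_ofReal_iff, Complex.ofReal_neg,
      Complex.ofReal_one]
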